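/- **Setting.** There are $n$ workers, $m$ firms and $J\ge 1$ education levels $\mathcal H=\{1,\dots,J\}$; all model parameters are fixed. Worker $i$ has private information $(X_i,\varepsilon_i)$, with $X_i$ a random element of a measurable space $\mathcal X$ (for instance a subset of $\mathbf R^d$) and $\varepsilon_i$ a random vector in $\mathbf R^J$. The firm variables $K=(K_j)_{j\le m}$ and $\eta=(\eta_j)_{j\le m}$ are real random variables not observed by the workers. After observing their own types, workers simultaneously choose levels $h_i\in\mathcal H$. The payoff of worker $i$ is $$u_i(h_i,h_{-i},x_i,k,\eta,\varepsilon_i)=\omega_i(h_i,h_{-i},x_i,k,\eta)-c(h_i,x_i,\varepsilon_i),$$ where $\omega_i$ is an arbitrary wage function, measurable in $(x_i,k,\eta)$, with $\omega_i(h,x,K,\eta)$ integrable for each fixed profile $h$ and each $x\in\mathcal X$, and $c(h_i,\cdot,\cdot)$ is a measurable cost function. A decision rule profile $\sigma=(\sigma_i)$ consists of measurable functions $\sigma_i:\mathcal X\times\mathbf R^J\to\mathcal H$. The expected utility of worker $i$ of type $(x,e)$ from level $a$ is $$U_i(a,x,e,\sigma)=\mathbf E\big[u_i\big(a,(\sigma_j(X_j,\varepsilon_j))_{j\ne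 i},x,K,\eta,e\big)\big].$$ The profile $\sigma$ is a Bayesian Nash equilibrium (BNE) if $\sigma_i(x,e)\in\arg\max_{a\in\mathcal H}U_i(a,x,e,\sigma)$ for every $i$ and every $(x,e)\in\mathcal X\times\mathbf R^J$. Its choice probabilities are $\mathbf P(\sigma)=\big(P_i(a|\sigma_i)\big)_{i\le n,\ a\in\mathcal H\setminus\{1\}}$, where $$P_i(a|\sigma_i)=\int\!\!\int 1\{\sigma_i(x,e)=a\}\,dF_{\varepsilon_i}(e)\,dF_{X_i}(x).$$ **Assumptions.** 1. (Independence.) The $K_j$ are independent across $j$, the $\eta_j$ are independent across $j$, the $X_i$ are independent across $i$, the $\varepsilon_i$ are independent across $i$, and the vectors $X,K,\varepsilon,\eta$ are mutually independent. The law of each $\varepsilon_i$ is absolutely continuous with respect to Lebesgue measure on $\mathbf R^J$. 2. (Separability.) $c(a,x,e)=c_0(a,x)+e'd(a)$, where $d(a)\in\mathbf R^J$ has a one in row $a$ and zeros elsewhere. **Best response probability map.** For $\mathbf P=(P_i(a))_{i\le n,\,a\ne1}\in\mathbf R^{n(J-1)}$ put $P_i(1)=1-\sum_{a\ne1}P_i(a)$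 and $$\tilde U_i(a,x,\mathbf P)=\sum_{h_{-i}\in\mathcal H^{n-1}}\big(\mathbf E[\omega_i(a,h_{-i},x,K,\eta)]-c_0(a,x)\big)\prod_{j\ne i}P_j(h_j),$$ $$\Psi_i(a|\mathbf P)=\int F_{\varepsilon_i}\Big(\Big\{e:\ \tilde U_i(b,x,\mathbf P)-e'd(b)<\tilde U_i(a,x,\mathbf P)-e'd(a)\ \text{ for all } b\neq a\Big\}\Big)\,dF_{X_i}(x),$$ where $F_{\varepsilon_i}$ also denotes the law of $\varepsilon_i$, and let $\Psi(\mathbf P)=(\Psi_i(a|\mathbf P))_{i\le n,\ a\in\mathcal H\setminus\{1\}}$. **Claim.** Under Assumptions 1 and 2 the game has a Bayesian Nash equilibrium. Moreover, $\Psi$ maps $[0,1]^{n(J-1)}$ into itself; for every BNE $\sigma$, the vector $\mathbf P(\sigma)$ lies in $[0,1]^{n(J-1)}$ and $\Psi(\mathbf P(\sigma))=\mathbf P(\sigma)$; and every fixed point $\mathbf P\in[0,1]^{n(J-1)}$ of $\Psi$ equals $\mathbf P(\sigma)$ for some BNE $\sigma$. -/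

import Mathlib

open MeasureTheory ProbabilityTheory

/-- The data of the pre-matching education game with `n` workers, `m` firms and education levels
`Fin J` (the index `0` is the lowest level, written `1` in `{1, …, J}`), at a fixed value of the
model parameters. Private covariates live in `𝒳`, private cost shocks in `ℝ^J`.
All random variables live on `Ω`. -/
structure EducationGame (n m J : ℕ) (𝒳 Ω : Type*) where
  /-- `wage i h x k η`: the wage of worker `i` with covariates `x` at the education profile
  `h = (hᵢ, h₋ᵢ)`, firm capital `k` and firm noise `η`. -/
  wage : Fin n → (Fin n → Fin J) → 𝒳 → (Fin m → ℝ) → (Fin m → ℝ) → ℝ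
  /-- `cost a x e`: the cost of education level `a` for a worker of type `(x, e)`. -/
  cost : Fin J → 𝒳 → (Fin J → ℝ) → ℝ
  /-- worker covariates `Xᵢ` -/
  X : Fin n → Ω → 𝒳
  /-- worker cost shocks `εᵢ` -/
  eps : Fin n → Ω → (Fin J → ℝ)
  /-- firm capital `Kⱼ` -/
  K : Fin m → Ω → ℝ
  /-- firm noise `ηⱼ` -/
  eta : Fin m → Ω → ℝ

namespace EducationGame

variable {n m J : ℕ} {𝒳 Ω : Type*} [MeasurableSpace 𝒳] [MeasurableSpace Ω]

/-- The ex post payoff of worker `i`: wage less cost of education. -/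
def payoff (G : EducationGame n m J 𝒳 Ω) (i : Fin n) (h : Fin n → Fin J) (x : 𝒳)
    (k η : Fin m → ℝ) (e : Fin J → ℝ) : ℝ :=
  G.wage i h x k η - G.cost (h i) x e

/-- Measurability of the primitives, and finiteness of the expected wage at every fixed education
profile and every fixed covariate. -/
structure Regular (G : EducationGame n m J 𝒳 Ω) (μ : Measure Ω) : Prop where
  measurable_wage : ∀ i h, Measurable
    (fun p : 𝒳 × (Fin m → ℝ) × (Fin m → ℝ) => G.wage i h p.1 p.2.1 p.2.2)
  measurable_cost : ∀ a, Measurable (fun p : 𝒳 × (Fin J → ℝ) => G.cost a p.1 p.2)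
  measurable_X : ∀ i, Measurable (G.X i)
  measurable_eps : ∀ i, Measurable (G.eps i)
  measurable_K : ∀ j, Measurable (G.K j)
  measurable_eta : ∀ j, Measurable (G.eta j)
  integrable_wage : ∀ i h x,
    Integrable (fun ω => G.wage i h x (fun j => G.K j ω) (fun j => G.eta j ω)) μ

/-- Independence of private information: the coordinates of each of the vectors `X`, `K`, `ε`, `η`
are independent, the four vectors are mutually independent, and each `εᵢ` is continuously
distributed, i.e. its law on `ℝ^J` is absolutely continuous. -/
structure IndependentInformation (G : EducationGame n m J 𝒳 Ω) (μ : Measure Ω) : Prop where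
  indep_K : iIndepFun G.K μ
  indep_eta : iIndepFun G.eta μ
  indep_X : iIndepFun G.X μ
  indep_eps : iIndepFun G.eps μ
  indep_vectors : iIndep
    ![MeasurableSpace.comap (fun ω i => G.X i ω) MeasurableSpace.pi,
      MeasurableSpace.comap (fun ω j => G.K j ω) MeasurableSpace.pi,
      MeasurableSpace.comap (fun ω i => G.eps i ω) MeasurableSpace.pi,
      MeasurableSpace.comap (fun ω j => G.eta j ω) MeasurableSpace.pi] μ
  continuous_eps : ∀ i, μ.map (G.eps i) ≪ volume

/-- The vector `d(a) ∈ ℝ^J` with a one in row `a` and zeros elsewhere. -/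
def unitVec (a : Fin J) : Fin J → ℝ := Pi.single a 1

/-- Additive separability of costs in private information, with systematic part `c₀`. -/
def SeparableCost (G : EducationGame n m J 𝒳 Ω) (c₀ : Fin J → 𝒳 → ℝ) : Prop :=
  ∀ a x e, G.cost a x e = c₀ a x + e ⬝ᵥ unitVec a

/-- The expected utility of worker `i` of type `(x, e)` who chooses level `a` while every other
worker `j` uses the decision rule `σ j`. The types of the others and the firm variables are drawn
from their unconditional law, which under independence is the law given the own type. -/
noncomputable def expectedUtility (G : EducationGame n m J 𝒳 Ω) (μ : Measure Ω)
    (σ : Fin n → 𝒳 → (Fin J → ℝ) → Fin J) (i : Fin n) (a : Fin J) (x : 𝒳) (e : Fin J → ℝ) : ℝ :=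
  ∫ ω, G.payoff i (Function.update (fun j => σ j (G.X j ω) (G.eps j ω)) i a) x
    (fun j => G.K j ω) (fun j => G.eta j ω) e ∂μ

/-- A Bayesian Nash equilibrium in (measurable, pure) decision rules: for every worker and every
type, the prescribed education level maximizes expected utility. -/
def IsBayesianNash (G : EducationGame n m J 𝒳 Ω) (μ : Measure Ω)
    (σ : Fin n → 𝒳 → (Fin J → ℝ) → Fin J) : Prop :=
  (∀ i, Measurable (fun p : 𝒳 × (Fin J → ℝ) => σ i p.1 p.2)) ∧
  ∀ i x e a, G.expectedUtility μ σ i a x e ≤ G.expectedUtility μ σ i (σ i x e) x e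

/-- The conditional choice probability `Pᵢ(a | x, σᵢ)`. -/
noncomputable def condChoiceProb (G : EducationGame n m J 𝒳 Ω) (μ : Measure Ω)
    (σ : Fin n → 𝒳 → (Fin J → ℝ) → Fin J) (i : Fin n) (a : Fin J) (x : 𝒳) : ℝ :=
  (μ.map (G.eps i)).real {e | σ i x e = a}

/-- The choice probabilities `Pᵢ(a | σᵢ)` of the non-base levels, as a point of `ℝ^{n(J-1)}`. -/
noncomputable def choiceProb [NeZero J] (G : EducationGame n m J 𝒳 Ω) (μ : Measure Ω)
    (σ : Fin n → 𝒳 → (Fin J → ℝ) → Fin J) : Fin n → {a : Fin J // a ≠ 0} → ℝ :=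
  fun i a => ∫ x, G.condChoiceProb μ σ i a x ∂(μ.map (G.X i))

/-- The probability of any level: the base level has the remaining mass. -/
noncomputable def fullProb [NeZero J] (P : Fin n → {a : Fin J // a ≠ 0} → ℝ)
    (j : Fin n) (a : Fin J) : ℝ :=
  if ha : a ≠ 0 then P j ⟨a, ha⟩ else 1 - ∑ b, P j b

/-- The profile `(a, h₋ᵢ)`. -/
def profile (i : Fin n) (a : Fin J) (h : {j : Fin n // j ≠ i} → Fin J) : Fin n → Fin J :=
  fun j => if hj : j ≠ i then h ⟨j, hj⟩ else a

/-- The expected wage at a fixed education profile, over the law of `(K, η)`. -/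
noncomputable def expectedWage (G : EducationGame n m J 𝒳 Ω) (μ : Measure Ω)
    (i : Fin n) (h : Fin n → Fin J) (x : 𝒳) : ℝ :=
  ∫ ω, G.wage i h x (fun j => G.K j ω) (fun j => G.eta j ω) ∂μ

/-- The systematic part of expected utility as a function of the choice probabilities of the
other workers. -/
noncomputable def systematicUtility [NeZero J] (G : EducationGame n m J 𝒳 Ω) (μ : Measure Ω)
    (c₀ : Fin J → 𝒳 → ℝ) (P : Fin n → {a : Fin J // a ≠ 0} → ℝ)
    (i : Fin n) (a : Fin J) (x : 𝒳) : ℝ :=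
  ∑ h : {j : Fin n // j ≠ i} → Fin J,
    (G.expectedWage μ i (profile i a h) x - c₀ a x) * ∏ j, fullProb P j.1 (h j)

/-- The conditional best response probability: the probability, over `εᵢ`, that `a` is the
(unique) optimal level of worker `i` with covariates `x`. -/
noncomputable def condBestResponseProb [NeZero J] (G : EducationGame n m J 𝒳 Ω) (μ : Measure Ω)
    (c₀ : Fin J → 𝒳 → ℝ) (P : Fin n → {a : Fin J // a ≠ 0} → ℝ)
    (i : Fin n) (a : Fin J) (x : 𝒳) : ℝ :=
  (μ.map (G.eps i)).real {e | ∀ b, b ≠ a →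
    G.systematicUtility μ c₀ P i b x - e ⬝ᵥ unitVec b <
      G.systematicUtility μ c₀ P i a x - e ⬝ᵥ unitVec a}

/-- The best response probability map `Ψ` on `ℝ^{n(J-1)}`. -/
noncomputable def bestResponseMap [NeZero J] (G : EducationGame n m J 𝒳 Ω) (μ : Measure Ω)
    (c₀ : Fin J → 𝒳 → ℝ) (P : Fin n → {a : Fin J // a ≠ 0} → ℝ) :
    Fin n → {a : Fin J // a ≠ 0} → ℝ :=
  fun i a => ∫ x, G.condBestResponseProb μ c₀ P i a x ∂(μ.map (G.X i))

end EducationGame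

/-- The cube `[0,1]^{n(J-1)}`. -/
def probCube (n J : ℕ) [NeZero J] : Set (Fin n → {a : Fin J // a ≠ 0} → ℝ) :=
  {P | ∀ i a, P i a ∈ Set.Icc (0 : ℝ) 1}

/-! Because types are independent across workers and of the firm variables, the strategies of the
others enter a worker's expected utility only through their choice probabilities: it equals
`systematicUtility` at `choiceProb σ`, minus the own shock of the chosen level
(`expectedUtility_eq`). An equilibrium is thus a profile that is optimal against its own choice
probabilities.

Absolute continuity of the shocks makes ties null, so any rule optimal against `P` has choice
probabilities `Ψ(P)`, however it breaks ties (`choiceProb_eq_bestResponseMap`). Hence equilibria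
give fixed points; conversely, a measurable argmax against a fixed point `P` has choice
probabilities `Ψ(P) = P` and so is an equilibrium. The absence of ties also makes `Ψ` continuous, by
dominated convergence, and Brouwer's theorem on the cube yields a fixed point.

Brouwer's theorem is obtained by the Milnor–Rogers volume argument. If `r` were a `C¹` retraction of
a ball onto its sphere, `x + t (r x - x)` would be a bijection of the ball for small `t`, so the
integral of its Jacobian, a polynomial in `t`, would be constantly the volume of the ball. At `t =
1` the Jacobian is that of `r`, which vanishes since `‖r‖` is constant. -/

/-! ### Brouwer's fixed point theorem. -/

open Set Metric in
/-- A map that is Lipschitz on a ball and vanishes on the bounding sphere is Lipschitz after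
extension by zero. -/
theorem lipschitzWith_indicator_closedBall {E F : Type*} [NormedAddCommGroup E] [NormedSpace ℝ E]
    [NormedAddCommGroup F] {g : E → F} {R : ℝ} {C : NNReal}
    (hg : LipschitzOnWith C g (closedBall 0 R)) (h0 : ∀ x ∈ sphere (0 : E) R, g x = 0) :
    LipschitzWith C ((closedBall (0 : E) R).indicator g) := by
  -- The segment from `x` to `y` meets the sphere at a point `z` where `g` vanishes, and `z` is no
  -- farther from `x` than `y` is.
  have key : ∀ x ∈ closedBall (0 : E) R, ∀ y ∉ closedBall (0 : E) R, ‖g x‖ ≤ C * dist x y := by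
    intro x hx y hy
    have hc : ContinuousOn (fun s : ℝ => ‖AffineMap.lineMap x y s‖) (Icc 0 1) := by
      have : Continuous (AffineMap.lineMap x y : ℝ → E) := AffineMap.lineMap_continuous
      fun_prop
    have hR : R ∈ Icc ‖AffineMap.lineMap x y (0 : ℝ)‖ ‖AffineMap.lineMap x y (1 : ℝ)‖ := by
      simp at hx hy ⊢
      exact ⟨hx, hy.le⟩
    obtain ⟨s, hs, hsR⟩ := intermediate_value_Icc zero_le_one hc hR
    set z := AffineMap.lineMap x y s with hz
    have hzR : z ∈ sphere (0 : E) R := by simpa using hsR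
    have h1 := hg.dist_le_mul x hx z (sphere_subset_closedBall hzR)
    rw [h0 z hzR, dist_zero_right, hz, dist_left_lineMap, Real.norm_of_nonneg hs.1] at h1
    refine h1.trans ?_
    gcongr
    exact mul_le_of_le_one_left dist_nonneg hs.2
  refine LipschitzWith.of_dist_le_mul fun x y => ?_
  by_cases hx : x ∈ closedBall (0 : E) R <;> by_cases hy : y ∈ closedBall (0 : E) R
  · rw [indicator_of_mem hx, indicator_of_mem hy]
    exact hg.dist_le_mul x hx y hy
  · rw [indicator_of_mem hx, indicator_of_notMem hy, dist_zero_right]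
    exact key x hx y hy
  · rw [indicator_of_notMem hx, indicator_of_mem hy, dist_zero_left, dist_comm]
    exact key y hy x hx
  · rw [indicator_of_notMem hx, indicator_of_notMem hy, dist_self]
    positivity

-- With `g₀` the extension of `g` by zero, `x ↦ y - t g₀ x` is a contraction, and its fixed point
-- solves the equation. That point is in the ball: outside, `g₀` vanishes and the point would be `y`
-- itself.
open Set Metric in
theorem exists_add_smul_eq_of_lipschitzOnWith {E : Type*} [NormedAddCommGroup E] [NormedSpace ℝ E]
    [CompleteSpace E] {g : E → E} {R : ℝ} {C : NNReal}
    (hg : LipschitzOnWith C g (closedBall 0 R)) (h0 : ∀ x ∈ sphere (0 : E) R, g x = 0)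
    {t : NNReal} (ht : t * C < 1) {y : E} (hy : y ∈ closedBall (0 : E) R) :
    ∃ x ∈ closedBall (0 : E) R, x + (t : ℝ) • g x = y := by
  set g₀ := (closedBall (0 : E) R).indicator g with hg₀
  have hlip := lipschitzWith_indicator_closedBall hg h0
  have hcon : ContractingWith (t * C) (fun x => y - (t : ℝ) • g₀ x) := by
    refine ⟨ht, LipschitzWith.of_dist_le_mul fun a b => ?_⟩
    rw [dist_sub_left, dist_smul₀, NNReal.norm_eq, NNReal.coe_mul, mul_assoc]
    gcongr
    exact hlip.dist_le_mul a b
  have hfix := hcon.fixedPoint_isFixedPt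
  set x := hcon.fixedPoint
  have hx : y - (t : ℝ) • g₀ x = x := hfix
  by_cases hxB : x ∈ closedBall (0 : E) R
  · refine ⟨x, hxB, ?_⟩
    rw [hg₀, indicator_of_mem hxB] at hx
    rw [← eq_sub_iff_add_eq, hx]
  · rw [hg₀, indicator_of_notMem hxB, smul_zero, sub_zero] at hx
    exact absurd (hx ▸ hy) hxB

-- Two points with the same image satisfy `dist a b ≤ t C dist a b` with `t C < 1`.
open Set in
theorem injOn_add_smul_of_lipschitzOnWith {E : Type*} [NormedAddCommGroup E] [NormedSpace ℝ E]
    {g : E → E} {s : Set E} {C : NNReal} (hg : LipschitzOnWith C g s) {t : NNReal}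
    (ht : t * C < 1) : InjOn (fun x => x + (t : ℝ) • g x) s := by
  intro a ha b hb hab
  have h1 : a - b = (t : ℝ) • (g b - g a) := by
    simp only at hab
    rw [smul_sub, sub_eq_sub_iff_add_eq_add, hab, add_comm]
  have h2 : dist a b ≤ (t * C : NNReal) * dist a b := by
    have := hg.dist_le_mul a ha b hb
    calc dist a b = t * dist (g a) (g b) := by
          rw [dist_eq_norm, h1, norm_smul, dist_comm (g a), dist_eq_norm, NNReal.norm_eq]
      _ ≤ t * (C * dist a b) := by gcongr
      _ = _ := by push_cast; ring
  have ht' : ((t * C : NNReal) : ℝ) < 1 := by exact_mod_cast ht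
  have := dist_nonneg (x := a) (y := b)
  exact dist_le_zero.1 (by nlinarith)

/-- `t ↦ det (1 + t A)` is a polynomial of degree at most the dimension. -/
theorem exists_polynomial_det_one_add_smul {E : Type*} [NormedAddCommGroup E] [NormedSpace ℝ E]
    [FiniteDimensional ℝ E] (A : E →L[ℝ] E) :
    ∃ p : Polynomial ℝ, p.natDegree ≤ Module.finrank ℝ E ∧
      ∀ t : ℝ, p.eval t = (ContinuousLinearMap.id ℝ E + t • A).det := by
  set b := Module.finBasis ℝ E
  set M := LinearMap.toMatrix b b (A : E →ₗ[ℝ] E)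
  refine ⟨((Polynomial.X : Polynomial ℝ) • M.map Polynomial.C +
    (1 : Matrix (Fin (Module.finrank ℝ E)) (Fin (Module.finrank ℝ E)) ℝ).map
      Polynomial.C).det, ?_, fun t => ?_⟩
  · simpa only [Fintype.card_fin] using Polynomial.natDegree_det_X_add_C_le M 1
  · rw [← Polynomial.coe_evalRingHom, RingHom.map_det, ContinuousLinearMap.det,
      ← LinearMap.det_toMatrix b]
    congr 1
    ext i j
    have h1 : (1 : Matrix (Fin (Module.finrank ℝ E)) (Fin (Module.finrank ℝ E)) ℝ) i j =
        LinearMap.toMatrix b b LinearMap.id i j := by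
      rw [LinearMap.toMatrix_id]
    rw [RingHom.mapMatrix_apply, Matrix.map_apply, Matrix.add_apply, Matrix.smul_apply,
      Matrix.map_apply, Matrix.map_apply, h1]
    simp [M, LinearMap.toMatrix_apply, add_comm]
    exact mul_comm _ _

-- A kernel vector of `1 + s A` would satisfy `‖v‖ ≤ s C ‖v‖`, so the determinant has no zero on
-- `[0, t]`; being `1` at `s = 0`, it stays positive.
open Set in
theorem det_id_add_smul_pos {E : Type*} [NormedAddCommGroup E] [NormedSpace ℝ E]
    [FiniteDimensional ℝ E] {A : E →L[ℝ] E} {C t : ℝ} (hA : ‖A‖ ≤ C) (ht0 : 0 ≤ t)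
    (ht : t * C < 1) : 0 < (ContinuousLinearMap.id ℝ E + t • A).det := by
  have hne : ∀ s ∈ Icc 0 t, (ContinuousLinearMap.id ℝ E + s • A).det ≠ 0 := by
    intro s hs h
    have hC : 0 ≤ C := (norm_nonneg _).trans hA
    obtain ⟨v, hv, hv0⟩ := Submodule.exists_mem_ne_zero_of_ne_bot
      (LinearMap.bot_lt_ker_of_det_eq_zero h).ne'
    have h1 : v + s • A v = 0 := by simpa using hv
    have h2 : ‖v‖ ≤ s * C * ‖v‖ := by
      have h3 : ‖A v‖ ≤ C * ‖v‖ := (A.le_opNorm v).trans (by gcongr)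
      have h4 : ‖v‖ = s * ‖A v‖ := by
        conv_lhs => rw [eq_neg_of_add_eq_zero_left h1]
        rw [norm_neg, norm_smul, Real.norm_of_nonneg hs.1]
      rw [mul_assoc]
      exact h4.trans_le (mul_le_mul_of_nonneg_left h3 hs.1)
    have h3 : s * C < 1 := (mul_le_mul_of_nonneg_right hs.2 hC).trans_lt ht
    have := norm_pos_iff.2 hv0
    nlinarith
  by_contra hle
  push Not at hle
  have hc : ContinuousOn (fun s : ℝ => (ContinuousLinearMap.id ℝ E + s • A).det) (Icc 0 t) :=
    (ContinuousLinearMap.continuous_det.comp (by fun_prop)).continuousOn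
  obtain ⟨s, hs, h0⟩ := intermediate_value_Icc' ht0 hc
    (show (0 : ℝ) ∈ Icc _ _ from ⟨hle, by simp [ContinuousLinearMap.det]⟩)
  exact hne s hs h0

open Set Metric in
/-- There is no continuously differentiable retraction of a closed ball onto its sphere. -/
theorem not_retraction_of_contDiffAt {E : Type*} [NormedAddCommGroup E] [InnerProductSpace ℝ E]
    [FiniteDimensional ℝ E] {R : ℝ} (hR : 0 < R) {r : E → E}
    (hr : ∀ x ∈ closedBall (0 : E) R, ContDiffAt ℝ 1 r x)
    (hmaps : ∀ x ∈ closedBall (0 : E) R, ‖r x‖ = R) (hid : ∀ x ∈ sphere (0 : E) R, r x = x) :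
    False := by
  let _ : MeasurableSpace E := borel E
  have : BorelSpace E := ⟨rfl⟩
  set B := closedBall (0 : E) R with hB
  have hBc : IsCompact B := isCompact_closedBall 0 R
  set g : E → E := fun x => r x - x with hgdef
  set D : E → (E →L[ℝ] E) := fun x => fderiv ℝ r x - ContinuousLinearMap.id ℝ E with hD
  have hrd : ∀ x ∈ B, HasFDerivAt r (fderiv ℝ r x) x := fun x hx =>
    ((hr x hx).differentiableAt one_ne_zero).hasFDerivAt
  have hgd : ∀ x ∈ B, HasFDerivAt g (D x) x := fun x hx => (hrd x hx).sub (hasFDerivAt_id x)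
  have hDc : ContinuousOn D B := by
    refine ContinuousOn.sub (fun x hx => ?_) continuousOn_const
    exact ((hr x hx).fderiv_right (m := 0) (by norm_num)).continuousAt.continuousWithinAt
  obtain ⟨C₀, hC₀⟩ := hBc.exists_bound_of_continuousOn hDc
  set C : NNReal := Real.toNNReal C₀
  have hC : ∀ x ∈ B, ‖D x‖ ≤ C := fun x hx => (hC₀ x hx).trans (Real.le_coe_toNNReal C₀)
  have hlip : LipschitzOnWith C g B := by
    refine Convex.lipschitzOnWith_of_nnnorm_fderiv_le (𝕜 := ℝ)
      (fun x hx => (hgd x hx).differentiableAt) (fun x hx => ?_) (convex_closedBall 0 R)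
    rw [(hgd x hx).fderiv]
    exact hC x hx
  have hg0 : ∀ x ∈ sphere (0 : E) R, g x = 0 := fun x hx => by simp [hgdef, hid x hx]
  -- For such `t` the perturbed identity is a bijection of the ball with positive Jacobian; change
  -- of variables gives the volume. Convexity, with `t ≤ 1`, keeps the image inside.
  have hvol : ∀ t : NNReal, t * C < 1 → t ≤ 1 →
      ∫ x in B, (ContinuousLinearMap.id ℝ E + (t : ℝ) • D x).det
        = (volume : Measure E).real B := by
    intro t ht ht1
    have himage : (fun x => x + (t : ℝ) • g x) '' B = B := by
      refine Subset.antisymm ?_ fun y hy => exists_add_smul_eq_of_lipschitzOnWith hlip hg0 ht hy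
      rintro _ ⟨x, hx, rfl⟩
      have h1 : x + (t : ℝ) • g x = (1 - (t : ℝ)) • x + (t : ℝ) • r x := by
        simp only [hgdef]; module
      simp only [h1]
      refine convex_closedBall 0 R hx ?_ ?_ t.2 (by ring)
      · simp [hmaps x hx]
      · exact sub_nonneg.2 (by exact_mod_cast ht1)
    have h := integral_image_eq_integral_abs_det_fderiv_smul (volume : Measure E)
      hBc.measurableSet
      (fun x hx => ((hasFDerivAt_id x).add ((hgd x hx).const_smul (t : ℝ))).hasFDerivWithinAt)
      (injOn_add_smul_of_lipschitzOnWith hlip ht) (fun _ => (1 : ℝ))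
    have himage' : (id + (t : ℝ) • g) '' B = B := himage
    rw [himage'] at h
    have h2 : ∫ _ in B, (1 : ℝ) = (volume : Measure E).real B := by simp
    rw [← h2, h]
    refine setIntegral_congr_fun hBc.measurableSet fun x hx => ?_
    have := det_id_add_smul_pos (hC x hx) t.2 (by exact_mod_cast ht)
    simp only [smul_eq_mul, mul_one]
    exact (abs_of_pos this).symm
  -- Differentiating `‖r‖² = R²` makes the range of `Dr` orthogonal to `r x ≠ 0`, so `Dr` is not
  -- onto. At boundary points the identity holds only within the ball, hence the use of unique
  -- differentiability there.
  have hdet0 : ∀ x ∈ B, (ContinuousLinearMap.id ℝ E + (1 : ℝ) • D x).det = 0 := by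
    intro x hx
    have hsum : ContinuousLinearMap.id ℝ E + (1 : ℝ) • D x = fderiv ℝ r x := by
      simp [hD]
    rw [hsum]
    by_contra hne
    have huniq : UniqueDiffWithinAt ℝ B x :=
      uniqueDiffOn_convex (convex_closedBall 0 R) ⟨0, by
        rw [interior_closedBall _ hR.ne']; exact mem_ball_self hR⟩ x hx
    have h1 := ((hrd x hx).inner ℝ (hrd x hx)).hasFDerivWithinAt (s := B)
    have h2 : HasFDerivWithinAt (fun y => inner ℝ (r y) (r y)) (0 : E →L[ℝ] ℝ) B x := by
      refine (hasFDerivWithinAt_const (R ^ 2) x B).congr (fun y hy => ?_) ?_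
      · rw [real_inner_self_eq_norm_sq, hmaps y hy]
      · rw [real_inner_self_eq_norm_sq, hmaps x hx]
    have h3 := huniq.eq h1 h2
    obtain ⟨w, hw⟩ := (LinearMap.equivOfDetNeZero _ hne).surjective (r x)
    have hw' : fderiv ℝ r x w = r x := hw
    have h4 := DFunLike.congr_fun h3 w
    simp [hw', fderivInnerCLM_apply, hmaps x hx, hR.ne'] at h4
  set N := Module.finrank ℝ E
  obtain ⟨δ, hδ0, hδ⟩ : ∃ δ : NNReal, 0 < δ ∧ δ * C < 1 ∧ δ ≤ 1 := by
    refine ⟨(C + 1)⁻¹, by positivity, ?_, inv_le_one_of_one_le₀ (by simp)⟩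
    rw [inv_mul_lt_iff₀ (by positivity)]
    simp
  -- `N + 1` distinct small parameters determine a polynomial of degree at most `N`; the weights `w`
  -- below extrapolate its value to `1`.
  set v : Fin (N + 1) → NNReal := fun k => δ / (k + 1) with hv
  have hvδ : ∀ k, v k ≤ δ := fun k => div_le_self zero_le (by simp)
  have hinj : InjOn (fun k => (v k : ℝ)) (Finset.univ : Finset (Fin (N + 1))) := by
    intro a _ b _ hab
    have : (δ : ℝ) ≠ 0 := by exact_mod_cast hδ0.ne'
    simp only [hv, NNReal.coe_div, NNReal.coe_add, NNReal.coe_one, NNReal.coe_natCast] at hab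
    field_simp at hab
    ext
    exact_mod_cast (add_right_cancel hab).symm
  set w : Fin (N + 1) → ℝ := fun k =>
    (Lagrange.basis Finset.univ (fun k => (v k : ℝ)) k).eval 1
  have hinterp : ∀ p : Polynomial ℝ, p.natDegree ≤ N →
      p.eval 1 = ∑ k, w k * p.eval (v k : ℝ) := by
    intro p hp
    have hdeg : p.degree < (Finset.univ : Finset (Fin (N + 1))).card := by
      rw [Finset.card_univ, Fintype.card_fin]
      exact (Polynomial.degree_le_of_natDegree_le hp).trans_lt (by exact_mod_cast N.lt_succ_self)
    conv_lhs => rw [Lagrange.eq_interpolate hinj hdeg, Lagrange.interpolate_apply]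
    simp [Polynomial.eval_finsetSum, w, mul_comm]
  have hw : ∑ k, w k = 1 := by simpa using (hinterp 1 (by simp)).symm
  -- Extrapolating pointwise in `x` avoids integrating the coefficients of the polynomial.
  -- Integrated, the same sum is the volume of the ball, as the weights add up to `1`.
  have hpoint : ∀ x ∈ B, ∑ k, w k * (ContinuousLinearMap.id ℝ E + (v k : ℝ) • D x).det = 0 := by
    intro x hx
    obtain ⟨p, hp, hpe⟩ := exists_polynomial_det_one_add_smul (D x)
    have := hinterp p hp
    simp only [hpe] at this
    rw [← this, hdet0 x hx]
  have hint : ∫ x in B, ∑ k, w k * (ContinuousLinearMap.id ℝ E + (v k : ℝ) • D x).det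
      = (volume : Measure E).real B := by
    rw [integral_finsetSum]
    · simp_rw [integral_const_mul]
      rw [Finset.sum_congr rfl fun k _ => by
        rw [hvol (v k) ((mul_le_mul_left (hvδ k) C).trans_lt hδ.1) ((hvδ k).trans hδ.2)]]
      rw [← Finset.sum_mul, hw, one_mul]
    · intro k _
      refine ContinuousOn.integrableOn_compact hBc ?_
      exact continuousOn_const.mul (ContinuousLinearMap.continuous_det.comp_continuousOn
        (continuousOn_const (c := ContinuousLinearMap.id ℝ E) |>.add (hDc.const_smul (v k : ℝ))))
  rw [setIntegral_congr_fun hBc.measurableSet hpoint] at hint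
  have hpos : 0 < (volume : Measure E).real B :=
    ENNReal.toReal_pos (measure_closedBall_pos _ _ hR).ne' hBc.measure_lt_top.ne
  simp at hint
  exact hpos.ne hint

open Set Metric in
/-- Brouwer's theorem for a continuously differentiable self-map of a closed ball. -/
theorem exists_fixedPoint_closedBall_of_contDiff {E : Type*} [NormedAddCommGroup E]
    [InnerProductSpace ℝ E] [FiniteDimensional ℝ E] {R : ℝ} (hR : 0 < R) {p : E → E}
    (hp : ContDiff ℝ 1 p) (hmaps : MapsTo p (closedBall 0 R) (closedBall 0 R)) :
    ∃ x ∈ closedBall (0 : E) R, p x = x := by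
  by_contra! hfix
  set u : E → E := fun x => x - p x with hu
  have hu0 : ∀ x ∈ closedBall (0 : E) R, u x ≠ 0 := fun x hx h =>
    hfix x hx (sub_eq_zero.1 h).symm
  -- This makes the discriminant below positive on the sphere and `l = 0` the chosen root there.
  have hu_pos : ∀ x ∈ sphere (0 : E) R, 0 < inner ℝ x (u x) := by
    intro x hx
    have hxR : ‖x‖ = R := by simpa using hx
    have hpR : ‖p x‖ ≤ R := by simpa using hmaps (sphere_subset_closedBall hx)
    have h1 : 0 < ‖x - p x‖ ^ 2 := by
      have := norm_pos_iff.2 (hu0 x (sphere_subset_closedBall hx))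
      positivity
    rw [norm_sub_sq_real, hxR] at h1
    rw [hu, inner_sub_right, real_inner_self_eq_norm_sq, hxR]
    nlinarith [norm_nonneg (p x)]
  -- `Δ` is a quarter of the discriminant of `‖x + l u‖² = R²`, a quadratic in `l`, and `l x` is its
  -- larger root: `x` is moved along the line through `p x` and `x`, away from `p x`, to the sphere.
  set Δ : E → ℝ := fun x => inner ℝ x (u x) ^ 2 + ‖u x‖ ^ 2 * (R ^ 2 - ‖x‖ ^ 2) with hΔ
  have hΔ_pos : ∀ x ∈ closedBall (0 : E) R, 0 < Δ x := by
    intro x hx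
    have hxR : ‖x‖ ≤ R := by simpa using hx
    have h0 := norm_pos_iff.2 (hu0 x hx)
    rcases hxR.lt_or_eq with h | h
    · have : 0 < R ^ 2 - ‖x‖ ^ 2 := by nlinarith [norm_nonneg x]
      simp only [hΔ]
      positivity
    · have := hu_pos x (by simpa using h)
      simp only [hΔ, h, sub_self, mul_zero, add_zero]
      positivity
  set l : E → ℝ := fun x => (-inner ℝ x (u x) + √(Δ x)) / ‖u x‖ ^ 2 with hl
  have hucd : ContDiff ℝ 1 u := contDiff_id.sub hp
  have hΔcd : ContDiff ℝ 1 Δ :=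
    ((contDiff_id.inner ℝ hucd).pow 2).add
      ((hucd.norm_sq ℝ).mul (contDiff_const.sub (contDiff_id.norm_sq ℝ)))
  refine not_retraction_of_contDiffAt hR (r := fun x => x + l x • u x) (fun x hx => ?_)
    (fun x hx => ?_) fun x hx => ?_
  · refine contDiffAt_id.add (ContDiffAt.smul (ContDiffAt.div ?_ ?_ ?_) hucd.contDiffAt)
    · exact (contDiff_id.inner ℝ hucd).neg.contDiffAt.add
        (hΔcd.contDiffAt.sqrt (hΔ_pos x hx).ne')
    · exact (hucd.norm_sq ℝ).contDiffAt
    · exact pow_ne_zero 2 (norm_ne_zero_iff.2 (hu0 x hx))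
  · have h0 : ‖u x‖ ^ 2 ≠ 0 := pow_ne_zero 2 (norm_ne_zero_iff.2 (hu0 x hx))
    have hs := Real.sq_sqrt (hΔ_pos x hx).le
    have h1 : ‖x + l x • u x‖ ^ 2 = R ^ 2 := by
      rw [norm_add_sq_real, inner_smul_right, norm_smul, mul_pow, Real.norm_eq_abs, sq_abs]
      simp only [hl]
      simp only [hΔ] at hs ⊢
      generalize √(inner ℝ x (u x) ^ 2 + ‖u x‖ ^ 2 * (R ^ 2 - ‖x‖ ^ 2)) = s at hs ⊢
      generalize inner ℝ x (u x) = a at hs ⊢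
      generalize ‖u x‖ ^ 2 = b at *
      field_simp
      linear_combination hs
    exact (sq_eq_sq₀ (norm_nonneg _) hR.le).1 h1
  · have hxR : ‖x‖ = R := by simpa using hx
    have : l x = 0 := by
      simp [hl, hΔ, hxR, Real.sqrt_sq (hu_pos x hx).le]
    simp [this]

open Set Metric in
/-- A continuous map of a finite-dimensional inner product space with bounded range has a
fixed point. -/
theorem exists_fixedPoint_of_continuous_of_bounded {E : Type*} [NormedAddCommGroup E]
    [InnerProductSpace ℝ E] [FiniteDimensional ℝ E] {R : ℝ} {f : E → E}
    (hf : Continuous f) (hR : ∀ x, ‖f x‖ ≤ R) : ∃ x, f x = x := by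
  have hR0 : 0 ≤ R := (norm_nonneg _).trans (hR 0)
  by_contra! hfix
  have hBc : IsCompact (closedBall (0 : E) (R + 1)) := isCompact_closedBall 0 _
  obtain ⟨x₀, -, hmin⟩ := hBc.exists_isMinOn ⟨0, by simp; linarith⟩
    (hf.dist continuous_id).continuousOn
  have hδ : 0 < dist (f x₀) x₀ := dist_pos.2 (hfix x₀)
  -- Error below `1` keeps `p` inside the ball of radius `R + 1`; error below the least displacement
  -- of `f` on that ball excludes a fixed point of `p` there.
  obtain ⟨p, hp, hpf, -⟩ := hf.exists_contDiff_approx (ε := fun _ => min 1 (dist (f x₀) x₀)) 1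
    continuous_const (fun _ => lt_min one_pos hδ)
  obtain ⟨x, hx, hpx⟩ := exists_fixedPoint_closedBall_of_contDiff (R := R + 1) (by linarith)
    (by exact_mod_cast hp) (fun x _ => by
      rw [mem_closedBall_zero_iff]
      have h1 := (hpf x).trans_le (min_le_left _ _)
      rw [dist_eq_norm] at h1
      have h2 := norm_le_norm_add_norm_sub (f x) (p x)
      rw [norm_sub_rev] at h2
      linarith [hR x])
  have h1 := (hpf x).trans_le (min_le_right _ _)
  rw [hpx, dist_comm] at h1
  exact h1.not_ge (hmin hx)

open Set in
/-- Brouwer's theorem for the unit cube. -/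
theorem exists_fixedPoint_unitCube {ι : Type*} [Fintype ι] {f : (ι → ℝ) → ι → ℝ}
    (hf : ContinuousOn f (Icc 0 1)) (hmaps : MapsTo f (Icc 0 1) (Icc 0 1)) :
    ∃ x ∈ Icc (0 : ι → ℝ) 1, f x = x := by
  -- Clamping to the cube makes `f ∘ c` continuous everywhere with bounded range; its fixed points
  -- lie in the cube, where `c` is the identity.
  set c : (ι → ℝ) → ι → ℝ := fun x => (x ⊔ 0) ⊓ 1 with hc
  have hc_mem : ∀ x, c x ∈ Icc (0 : ι → ℝ) 1 := fun x =>
    ⟨le_inf le_sup_right zero_le_one, inf_le_right⟩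
  have hc_id : ∀ x ∈ Icc (0 : ι → ℝ) 1, c x = x := fun x hx => by
    simp [hc, sup_eq_left.2 hx.1, inf_eq_left.2 hx.2]
  have hcc : Continuous c := by
    refine continuous_pi fun i => ?_
    simp only [hc, Pi.inf_apply, Pi.sup_apply]
    fun_prop
  have hfc : Continuous (fun x => f (c x)) := hf.comp_continuous hcc hc_mem
  obtain ⟨R, hR⟩ := (isCompact_Icc (a := (0 : ι → ℝ)) (b := 1)).exists_bound_of_continuousOn
    (PiLp.continuous_toLp 2 (fun _ : ι => ℝ)).continuousOn
  obtain ⟨x, hx⟩ := exists_fixedPoint_of_continuous_of_bounded (E := EuclideanSpace ℝ ι) (R := R)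
    (f := fun x => WithLp.toLp 2 (f (c x.ofLp)))
    ((PiLp.continuous_toLp 2 _).comp (hfc.comp (PiLp.continuous_ofLp 2 _)))
    (fun x => hR _ (hmaps (hc_mem _)))
  have hx' : f (c x.ofLp) = x.ofLp := congrArg WithLp.ofLp hx
  have hmem : x.ofLp ∈ Icc (0 : ι → ℝ) 1 := hx' ▸ hmaps (hc_mem _)
  exact ⟨x.ofLp, hmem, by rwa [hc_id _ hmem] at hx'⟩

/-! ### Measurable selection, null ties, independence of pairs. -/

/-- A maximizer over finitely many alternatives can be selected measurably. -/
theorem exists_measurable_argmax {α : Type*} [MeasurableSpace α] {J : ℕ} [NeZero J]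
    {V : Fin J → α → ℝ} (hV : ∀ a, Measurable (V a)) :
    ∃ f : α → Fin J, Measurable f ∧ ∀ z b, V b z ≤ V (f z) z := by
  -- The least maximizer is unique, so its level sets are cut out by inequalities.
  have hex : ∀ z, ∃ a, (∀ b, V b z ≤ V a z) ∧ ∀ b < a, V b z < V a z := by
    intro z
    have hne : {a | ∀ b, V b z ≤ V a z}.Nonempty :=
      let ⟨a, ha⟩ := Finite.exists_max (fun b => V b z)
      ⟨a, ha⟩
    obtain ⟨a, ha, hmin⟩ := WellFounded.has_min (wellFounded_lt (α := Fin J)) _ hne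
    refine ⟨a, ha, fun b hb => lt_of_not_ge fun hab => hmin b (fun c => ?_) hb⟩
    exact (ha c).trans hab
  choose f hf using hex
  refine ⟨f, measurable_to_countable' fun a => ?_, fun z => (hf z).1⟩
  have : f ⁻¹' {a} = {z | ∀ b, V b z ≤ V a z} ∩ {z | ∀ b < a, V b z < V a z} := by
    ext z
    simp only [Set.mem_preimage, Set.mem_singleton_iff, Set.mem_inter_iff, Set.mem_ofPred_eq]
    refine ⟨fun h => h ▸ hf z, fun h => ?_⟩
    rcases lt_trichotomy (f z) a with hlt | heq | hgt
    · exact absurd ((hf z).1 a) (not_le.2 (h.2 _ hlt))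
    · exact heq
    · exact absurd (h.1 (f z)) (not_le.2 ((hf z).2 _ hgt))
  rw [this]
  refine MeasurableSet.inter ?_ ?_
  · rw [Set.ofPred_forall]
    exact MeasurableSet.iInter fun b => measurableSet_le (hV b) (hV a)
  · simp only [Set.ofPred_forall]
    exact MeasurableSet.iInter fun b => MeasurableSet.iInter fun _ => measurableSet_lt (hV b) (hV a)

/-- Under an absolutely continuous law two distinct coordinates almost never differ by a given
constant. -/
theorem ae_sub_ne_of_absolutelyContinuous {ι : Type*} [Fintype ι] {ν : Measure (ι → ℝ)}
    (hν : ν ≪ volume) {a b : ι} (hab : a ≠ b) (c : ℝ) : ∀ᵐ e ∂ν, e a - e b ≠ c := by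
  classical
  suffices h : ∀ᵐ e : ι → ℝ, e a - e b ≠ c from hν.ae_le h
  set L : (ι → ℝ) →ₗ[ℝ] ℝ :=
    LinearMap.proj (R := ℝ) (φ := fun _ => ℝ) a - LinearMap.proj (R := ℝ) (φ := fun _ => ℝ) b
  -- The tie set is a proper affine subspace, hence Lebesgue null.
  set S : AffineSubspace ℝ (ι → ℝ) :=
    (AffineSubspace.mk' c (⊥ : Submodule ℝ ℝ)).comap L.toAffineMap
  have hS : ∀ e, e ∈ S ↔ e a - e b = c := by
    intro e
    simp [S, L, AffineSubspace.mem_mk', sub_eq_zero]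
  have hne : S ≠ ⊤ := by
    intro h
    have h1 := (hS (Pi.single a (c + 1))).1 (h ▸ AffineSubspace.mem_top ℝ _ _)
    simp [hab.symm] at h1
  rw [ae_iff]
  convert Measure.addHaar_affineSubspace volume S hne using 2
  ext e
  simp [hS e]

/-- The probability of a product-measurable event is the mean of its sections. -/
theorem integral_measureReal_section {α β : Type*} [MeasurableSpace α] [MeasurableSpace β]
    (μ : Measure α) (ν : Measure β) [IsFiniteMeasure ν] {s : Set (α × β)} (hs : MeasurableSet s) :
    ∫ x, ν.real {y | (x, y) ∈ s} ∂μ = (μ.prod ν).real s := by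
  rw [measureReal_def, Measure.prod_apply hs,
    ← integral_toReal (measurable_measure_prodMk_left hs).aemeasurable
      (Filter.Eventually.of_forall fun x => measure_lt_top _ _)]
  rfl

/-- If two random vectors are independent and each has independent coordinates, then the pairs of
coordinates are independent. -/
theorem iIndepFun_prodMk_of_indepFun {Ω ι α β : Type*} [MeasurableSpace Ω] [Fintype ι]
    [MeasurableSpace α] [MeasurableSpace β] {μ : Measure Ω} [IsProbabilityMeasure μ]
    {X : ι → Ω → α} {Y : ι → Ω → β} (mX : ∀ i, Measurable (X i)) (mY : ∀ i, Measurable (Y i))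
    (hX : iIndepFun X μ) (hY : iIndepFun Y μ)
    (hXY : IndepFun (fun ω i => X i ω) (fun ω i => Y i ω) μ) :
    iIndepFun (fun i ω => (X i ω, Y i ω)) μ := by
  have hpX : ∀ i, IsProbabilityMeasure (μ.map (X i)) := fun i =>
    Measure.isProbabilityMeasure_map (mX i).aemeasurable
  have hpY : ∀ i, IsProbabilityMeasure (μ.map (Y i)) := fun i =>
    Measure.isProbabilityMeasure_map (mY i).aemeasurable
  have hpair : ∀ i, μ.map (fun ω => (X i ω, Y i ω)) = (μ.map (X i)).prod (μ.map (Y i)) := fun i =>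
    (indepFun_iff_map_prod_eq_prod_map_map (mX i).aemeasurable (mY i).aemeasurable).1
      (hXY.comp (measurable_pi_apply i) (measurable_pi_apply i))
  rw [iIndepFun_iff_map_fun_eq_pi_map fun i => ((mX i).prodMk (mY i)).aemeasurable]
  simp_rw [hpair]
  have h1 := (indepFun_iff_map_prod_eq_prod_map_map (measurable_pi_lambda _ mX).aemeasurable
    (measurable_pi_lambda _ mY).aemeasurable).1 hXY
  rw [(iIndepFun_iff_map_fun_eq_pi_map fun i => (mX i).aemeasurable).1 hX,
    (iIndepFun_iff_map_fun_eq_pi_map fun i => (mY i).aemeasurable).1 hY] at h1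
  have h2 := (measurePreserving_arrowProdEquivProdArrow α β ι (fun i => μ.map (X i))
    (fun i => μ.map (Y i))).symm
  rw [← h2.map_eq, ← h1, Measure.map_map h2.measurable (by fun_prop)]
  rfl

/-! ### Expected utility in terms of choice probabilities. -/

namespace EducationGame

theorem dotProduct_unitVec {J : ℕ} (e : Fin J → ℝ) (a : Fin J) : e ⬝ᵥ unitVec a = e a := by
  simp [unitVec]

theorem continuous_systematicUtility {n m J : ℕ} {𝒳 Ω : Type*} [MeasurableSpace Ω] {μ : Measure Ω}
    {G : EducationGame n m J 𝒳 Ω} {c₀ : Fin J → 𝒳 → ℝ} [NeZero J] (i : Fin n) (a : Fin J) (x : 𝒳) :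
    Continuous fun P => G.systematicUtility μ c₀ P i a x := by
  unfold systematicUtility
  refine continuous_finsetSum _ fun h _ => continuous_const.mul
    (continuous_finsetProd _ fun j _ => ?_)
  unfold fullProb
  split_ifs <;> fun_prop

section

variable {n m J : ℕ} {𝒳 Ω : Type*} [MeasurableSpace 𝒳] [MeasurableSpace Ω]
  {μ : Measure Ω} {G : EducationGame n m J 𝒳 Ω} {c₀ : Fin J → 𝒳 → ℝ}

theorem SeparableCost.measurable (hsep : G.SeparableCost c₀) (hreg : G.Regular μ) (a : Fin J) :
    Measurable (c₀ a) := by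
  have h : c₀ a = fun x => G.cost a x 0 := by
    funext x
    simp [hsep a x 0]
  rw [h]
  exact (hreg.measurable_cost a).comp (measurable_id.prodMk measurable_const)

theorem Regular.measurable_expectedWage [SFinite μ] (hreg : G.Regular μ) (i : Fin n)
    (h : Fin n → Fin J) : Measurable (G.expectedWage μ i h) := by
  have hK := measurable_pi_lambda _ hreg.measurable_K
  have heta := measurable_pi_lambda _ hreg.measurable_eta
  refine (StronglyMeasurable.integral_prod_right
    (Measurable.stronglyMeasurable ?_)).measurable
  exact (hreg.measurable_wage i h).comp
    (measurable_fst.prodMk ((hK.comp measurable_snd).prodMk (heta.comp measurable_snd)))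

theorem measurable_systematicUtility [NeZero J] [SFinite μ] (hreg : G.Regular μ)
    (hsep : G.SeparableCost c₀) (P : Fin n → {a : Fin J // a ≠ 0} → ℝ) (i : Fin n) (a : Fin J) :
    Measurable (G.systematicUtility μ c₀ P i a) := by
  unfold systematicUtility
  exact Finset.measurable_sum _ fun h _ => ((hreg.measurable_expectedWage i _).sub
    (hsep.measurable hreg a)).mul_const _

theorem IndependentInformation.indepFun_X_eps (hindep : G.IndependentInformation μ) :
    IndepFun (fun ω i => G.X i ω) (fun ω i => G.eps i ω) μ :=
  (IndepFun_iff_Indep _ _ _).2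
    (hindep.indep_vectors.indep (i := 0) (j := 2) (by decide))

theorem IndependentInformation.indepFun_types_firms (hreg : G.Regular μ)
    (hindep : G.IndependentInformation μ) :
    IndepFun (fun ω => ((fun i => G.X i ω), fun i => G.eps i ω))
      (fun ω => ((fun j => G.K j ω), fun j => G.eta j ω)) μ := by
  rw [IndepFun_iff_Indep]
  -- In `indep_vectors`, positions `0, 2` are `X, ε` and positions `1, 3` are `K, η`.
  have h := indep_iSup_of_disjoint (fun k => ?_) hindep.indep_vectors
    (S := {0, 2}) (T := {1, 3}) (by simp)
  · simp only [iSup_insert, iSup_singleton] at h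
    refine indep_of_indep_of_le_left (indep_of_indep_of_le_right h ?_) ?_
    · exact (MeasurableSpace.comap_prodMk _ _).le
    · exact (MeasurableSpace.comap_prodMk _ _).le
  · fin_cases k
    · exact (measurable_pi_lambda _ hreg.measurable_X).comap_le
    · exact (measurable_pi_lambda _ hreg.measurable_K).comap_le
    · exact (measurable_pi_lambda _ hreg.measurable_eps).comap_le
    · exact (measurable_pi_lambda _ hreg.measurable_eta).comap_le

theorem integral_condChoiceProb [IsProbabilityMeasure μ] (hreg : G.Regular μ)
    (hindep : G.IndependentInformation μ) {σ : Fin n → 𝒳 → (Fin J → ℝ) → Fin J} {i : Fin n}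
    (hσ : Measurable fun p : 𝒳 × (Fin J → ℝ) => σ i p.1 p.2) (a : Fin J) :
    ∫ x, G.condChoiceProb μ σ i a x ∂(μ.map (G.X i)) =
      μ.real ((fun ω => σ i (G.X i ω) (G.eps i ω)) ⁻¹' {a}) := by
  have hS : MeasurableSet ((fun p : 𝒳 × (Fin J → ℝ) => σ i p.1 p.2) ⁻¹' {a}) :=
    hσ (measurableSet_singleton a)
  have := Measure.isProbabilityMeasure_map (μ := μ) (hreg.measurable_eps i).aemeasurable
  refine (integral_measureReal_section (μ.map (G.X i)) (μ.map (G.eps i)) hS).trans ?_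
  rw [← (indepFun_iff_map_prod_eq_prod_map_map (hreg.measurable_X i).aemeasurable
    (hreg.measurable_eps i).aemeasurable).1
      (hindep.indepFun_X_eps.comp (measurable_pi_apply i) (measurable_pi_apply i)),
    map_measureReal_apply ((hreg.measurable_X i).prodMk (hreg.measurable_eps i)) hS]
  rfl

theorem fullProb_choiceProb [NeZero J] [IsProbabilityMeasure μ] (hreg : G.Regular μ)
    (hindep : G.IndependentInformation μ) {σ : Fin n → 𝒳 → (Fin J → ℝ) → Fin J} {i : Fin n}
    (hσ : Measurable fun p : 𝒳 × (Fin J → ℝ) => σ i p.1 p.2) (a : Fin J) :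
    fullProb (G.choiceProb μ σ) i a =
      μ.real ((fun ω => σ i (G.X i ω) (G.eps i ω)) ⁻¹' {a}) := by
  have hτ : Measurable fun ω => σ i (G.X i ω) (G.eps i ω) :=
    hσ.comp ((hreg.measurable_X i).prodMk (hreg.measurable_eps i))
  unfold fullProb choiceProb
  simp only [integral_condChoiceProb hreg hindep hσ]
  split_ifs with ha
  · rfl
  · have hsum := sum_measureReal_preimage_singleton (μ := μ) (Finset.univ : Finset (Fin J))
      (f := fun ω => σ i (G.X i ω) (G.eps i ω)) (fun y _ => hτ (measurableSet_singleton y))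
    rw [not_not.1 ha]
    simp only [Finset.coe_univ, Set.preimage_univ, probReal_univ] at hsum
    rw [← hsum, Fintype.sum_eq_add_sum_subtype_ne _ (0 : Fin J), add_sub_cancel_right]

end

end EducationGame

namespace EducationGame

section

variable {n m J : ℕ} {𝒳 Ω : Type*} [MeasurableSpace 𝒳] [MeasurableSpace Ω]
  {μ : Measure Ω} {G : EducationGame n m J 𝒳 Ω} {c₀ : Fin J → 𝒳 → ℝ}

/-- The chosen levels of the workers other than `i` are independent. -/
theorem measureReal_iInter_choice [IsProbabilityMeasure μ] (hreg : G.Regular μ)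
    (hindep : G.IndependentInformation μ) {σ : Fin n → 𝒳 → (Fin J → ℝ) → Fin J}
    (hσ : ∀ i, Measurable fun p : 𝒳 × (Fin J → ℝ) => σ i p.1 p.2) (i : Fin n)
    (h : {j : Fin n // j ≠ i} → Fin J) :
    μ.real (⋂ j, (fun ω => σ j.1 (G.X j.1 ω) (G.eps j.1 ω)) ⁻¹' {h j}) =
      ∏ j, μ.real ((fun ω => σ j.1 (G.X j.1 ω) (G.eps j.1 ω)) ⁻¹' {h j}) := by
  have hpairs := iIndepFun_prodMk_of_indepFun hreg.measurable_X hreg.measurable_eps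
    hindep.indep_X hindep.indep_eps hindep.indepFun_X_eps
  have hτ := (hpairs.comp (fun j p => σ j p.1 p.2) hσ).precomp
    (Subtype.val_injective (p := fun j => j ≠ i))
  have := hτ.measure_inter_preimage_eq_mul Finset.univ (sets := fun j => {h j})
    (fun j _ => measurableSet_singleton _)
  simp only [Finset.mem_univ, Set.iInter_true] at this
  exact (congrArg ENNReal.toReal this).trans (ENNReal.toReal_prod _ _)

/-- Split `Ω` by the levels `h` that the others choose. On each piece the wage is taken at a fixed
profile and depends on the firms only, so its integral factors; the probability of the piece is a
product by independence across workers. These products add up to `1`, so the cost comes out of the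
sum. -/
theorem expectedUtility_eq [NeZero J] [IsProbabilityMeasure μ] (hreg : G.Regular μ)
    (hindep : G.IndependentInformation μ) (hsep : G.SeparableCost c₀)
    {σ : Fin n → 𝒳 → (Fin J → ℝ) → Fin J}
    (hσ : ∀ i, Measurable fun p : 𝒳 × (Fin J → ℝ) => σ i p.1 p.2) (i : Fin n) (a : Fin J)
    (x : 𝒳) (e : Fin J → ℝ) :
    G.expectedUtility μ σ i a x e =
      G.systematicUtility μ c₀ (G.choiceProb μ σ) i a x - e ⬝ᵥ unitVec a := by
  set τ : Fin n → Ω → Fin J := fun j ω => σ j (G.X j ω) (G.eps j ω) with hτ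
  set S : ({j : Fin n // j ≠ i} → Fin J) → Set Ω := fun h => ⋂ j, τ j.1 ⁻¹' {h j} with hS
  set W : ({j : Fin n // j ≠ i} → Fin J) → Ω → ℝ := fun h ω =>
    G.wage i (profile i a h) x (fun j => G.K j ω) (fun j => G.eta j ω) with hW
  have hτm : ∀ j, Measurable (τ j) := fun j =>
    (hσ j).comp ((hreg.measurable_X j).prodMk (hreg.measurable_eps j))
  have hSm : ∀ h, MeasurableSet (S h) := fun h =>
    MeasurableSet.iInter fun j => hτm j.1 (measurableSet_singleton _)
  have hWi : ∀ h, Integrable (W h) μ := fun h => hreg.integrable_wage i _ x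
  have hsum : ∀ ω, G.wage i (Function.update (fun j => σ j (G.X j ω) (G.eps j ω)) i a) x
      (fun j => G.K j ω) (fun j => G.eta j ω) = ∑ h, (S h).indicator (W h) ω := by
    intro ω
    rw [Finset.sum_eq_single (fun j => τ j.1 ω)]
    · rw [Set.indicator_of_mem (by simp [hS])]
      simp only [hW]
      congr 1
      funext j
      by_cases hj : j = i
      · subst hj; simp [profile]
      · simp [profile, hj, hτ]
    · intro h _ hne
      refine Set.indicator_of_notMem (fun hmem => hne ?_) _
      funext j
      exact (Set.mem_iInter.1 hmem j).symm
    · simp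
  have hfactor : ∀ h, ∫ ω, (S h).indicator (W h) ω ∂μ =
      G.expectedWage μ i (profile i a h) x * ∏ j, fullProb (G.choiceProb μ σ) j.1 (h j) := by
    intro h
    set T : Set ((Fin n → 𝒳) × (Fin n → Fin J → ℝ)) :=
      ⋂ j : {j : Fin n // j ≠ i}, (fun p => σ j.1 (p.1 j.1) (p.2 j.1)) ⁻¹' {h j} with hT
    have hTm : MeasurableSet T := MeasurableSet.iInter fun j =>
      have hj : Measurable fun p : (Fin n → 𝒳) × (Fin n → Fin J → ℝ) =>
          σ j.1 (p.1 j.1) (p.2 j.1) :=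
        (hσ j.1).comp (g := fun p : 𝒳 × (Fin J → ℝ) => σ j.1 p.1 p.2)
          (f := fun p : (Fin n → 𝒳) × (Fin n → Fin J → ℝ) => (p.1 j.1, p.2 j.1))
          (((measurable_pi_apply j.1).comp measurable_fst).prodMk
            ((measurable_pi_apply j.1).comp measurable_snd))
      hj (measurableSet_singleton _)
    have hind : IndepFun ((S h).indicator (1 : Ω → ℝ)) (W h) μ := by
      have h0 := (hindep.indepFun_types_firms hreg).comp
        (φ := T.indicator (1 : (Fin n → 𝒳) × (Fin n → Fin J → ℝ) → ℝ))
        (ψ := fun q : (Fin m → ℝ) × (Fin m → ℝ) => G.wage i (profile i a h) x q.1 q.2)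
        (measurable_one.indicator hTm)
        ((hreg.measurable_wage i _).comp (measurable_const.prodMk measurable_id))
      have hST : S h = (fun ω => ((fun i => G.X i ω), fun i => G.eps i ω)) ⁻¹' T := by
        simp only [hS, hT, hτ, Set.preimage_iInter]
        rfl
      rw [hST]
      exact h0
    have hmul : (S h).indicator (W h) = fun ω => (S h).indicator (1 : Ω → ℝ) ω * W h ω := by
      funext ω
      by_cases hω : ω ∈ S h <;> simp [hω]
    rw [hmul, hind.integral_fun_mul_eq_mul_integral
      (measurable_one.indicator (hSm h)).aestronglyMeasurable (hWi h).aestronglyMeasurable,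
      integral_indicator_one (hSm h), measureReal_iInter_choice hreg hindep hσ, mul_comm]
    congr 1
    exact Finset.prod_congr rfl fun j _ => (fullProb_choiceProb hreg hindep (hσ j.1) (h j)).symm
  have hprob : ∑ h : {j : Fin n // j ≠ i} → Fin J,
      ∏ j, fullProb (G.choiceProb μ σ) j.1 (h j) = 1 := by
    rw [← Fintype.prod_sum (fun (j : {j : Fin n // j ≠ i}) b =>
      fullProb (G.choiceProb μ σ) j.1 b)]
    refine Finset.prod_eq_one fun j _ => ?_
    rw [Fintype.sum_eq_add_sum_subtype_ne _ (0 : Fin J)]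
    have hne : ∀ b : {b : Fin J // b ≠ 0},
        fullProb (G.choiceProb μ σ) j.1 b.1 = G.choiceProb μ σ j.1 b :=
      fun b => dif_pos b.2
    simp only [hne]
    simp [fullProb]
  have hii : ∀ h, Integrable ((S h).indicator (W h)) μ := fun h => (hWi h).indicator (hSm h)
  unfold expectedUtility payoff systematicUtility
  simp only [Function.update_self, hsep a x e]
  simp only [hsum]
  rw [integral_sub (integrable_finsetSum _ fun h _ => hii h) (integrable_const _),
    integral_finsetSum _ fun h _ => hii h, Finset.sum_congr rfl fun h _ => hfactor h]
  simp only [sub_mul, Finset.sum_sub_distrib, ← Finset.mul_sum, hprob]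
  simp only [integral_const, probReal_univ, smul_eq_mul]
  ring

/-! ### The best response map, its fixed points and equilibria. -/

theorem measurableSet_strictBest {α : Type*} [MeasurableSpace α] {V : Fin J → α → ℝ}
    (hV : ∀ a, Measurable (V a)) (a : Fin J) :
    MeasurableSet {z | ∀ b, b ≠ a → V b z < V a z} := by
  simp only [Set.ofPred_forall]
  exact MeasurableSet.iInter fun b => MeasurableSet.iInter fun _ => measurableSet_lt (hV b) (hV a)

/-- For almost every cost shock no two levels give the same utility. -/
theorem IndependentInformation.ae_noTies (hindep : G.IndependentInformation μ) (i : Fin n)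
    (v : Fin J → ℝ) : ∀ᵐ e ∂(μ.map (G.eps i)), ∀ a b, a ≠ b →
      v a - e ⬝ᵥ unitVec a ≠ v b - e ⬝ᵥ unitVec b := by
  simp only [dotProduct_unitVec, ae_all_iff]
  intro a b hab
  filter_upwards [ae_sub_ne_of_absolutelyContinuous (hindep.continuous_eps i) hab (v a - v b)]
    with e he h
  exact he (by linarith)

/-- If `σ` prescribes optimal levels against the choice probabilities `P`, its choice
probabilities are the best response probabilities. -/
theorem choiceProb_eq_bestResponseMap [NeZero J] (hindep : G.IndependentInformation μ)
    {P : Fin n → {a : Fin J // a ≠ 0} → ℝ} {σ : Fin n → 𝒳 → (Fin J → ℝ) → Fin J}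
    (hopt : ∀ i x e a, G.systematicUtility μ c₀ P i a x - e ⬝ᵥ unitVec a ≤
      G.systematicUtility μ c₀ P i (σ i x e) x - e ⬝ᵥ unitVec (σ i x e)) :
    G.choiceProb μ σ = G.bestResponseMap μ c₀ P := by
  funext i a
  refine integral_congr_ae (Filter.Eventually.of_forall fun x => measureReal_congr ?_)
  -- Away from ties, an optimal level is strictly best; a strictly best level is always the only
  -- optimal one.
  filter_upwards [hindep.ae_noTies i fun a => G.systematicUtility μ c₀ P i a x] with e he
  refine propext ⟨fun (h : σ i x e = a) b hb => ?_, fun h => ?_⟩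
  · exact lt_of_le_of_ne (h ▸ hopt i x e b) (he b _ hb)
  · by_contra hne
    exact (hopt i x e a).not_gt (h _ hne)

theorem choiceProb_mem_probCube [NeZero J] [IsProbabilityMeasure μ] (hreg : G.Regular μ)
    (hindep : G.IndependentInformation μ) {σ : Fin n → 𝒳 → (Fin J → ℝ) → Fin J}
    (hσ : ∀ i, Measurable fun p : 𝒳 × (Fin J → ℝ) => σ i p.1 p.2) :
    G.choiceProb μ σ ∈ probCube n J := by
  intro i a
  have : G.choiceProb μ σ i a = _ := integral_condChoiceProb hreg hindep (hσ i) a.1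
  rw [this]
  exact ⟨measureReal_nonneg, measureReal_le_one⟩

theorem condBestResponseProb_mem_Icc [NeZero J] [IsProbabilityMeasure μ] (hreg : G.Regular μ)
    (P : Fin n → {a : Fin J // a ≠ 0} → ℝ) (i : Fin n) (a : Fin J) (x : 𝒳) :
    G.condBestResponseProb μ c₀ P i a x ∈ Set.Icc (0 : ℝ) 1 :=
  have := Measure.isProbabilityMeasure_map (μ := μ) (hreg.measurable_eps i).aemeasurable
  ⟨measureReal_nonneg, measureReal_le_one⟩

theorem mapsTo_bestResponseMap [NeZero J] [IsProbabilityMeasure μ] (hreg : G.Regular μ) :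
    Set.MapsTo (G.bestResponseMap μ c₀) (probCube n J) (probCube n J) := by
  intro P _ i a
  have := Measure.isProbabilityMeasure_map (μ := μ) (hreg.measurable_X i).aemeasurable
  have h := fun x => condBestResponseProb_mem_Icc (c₀ := c₀) hreg P i a.1 x
  refine ⟨integral_nonneg fun x => (h x).1, ?_⟩
  refine (integral_mono_of_nonneg (Filter.Eventually.of_forall fun x => (h x).1)
    (integrable_const (1 : ℝ)) (Filter.Eventually.of_forall fun x => (h x).2)).trans ?_
  simp

theorem measurable_condBestResponseProb [NeZero J] [IsProbabilityMeasure μ] (hreg : G.Regular μ)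
    (hsep : G.SeparableCost c₀) (P : Fin n → {a : Fin J // a ≠ 0} → ℝ) (i : Fin n) (a : Fin J) :
    Measurable (G.condBestResponseProb μ c₀ P i a) := by
  have := Measure.isProbabilityMeasure_map (μ := μ) (hreg.measurable_eps i).aemeasurable
  have hS := measurableSet_strictBest
    (V := fun b (p : 𝒳 × (Fin J → ℝ)) =>
      G.systematicUtility μ c₀ P i b p.1 - p.2 ⬝ᵥ unitVec b) (fun b => by
        simp only [dotProduct_unitVec]
        exact ((measurable_systematicUtility hreg hsep P i b).comp measurable_fst).sub
          ((measurable_pi_apply b).comp measurable_snd)) a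
  exact (measurable_measure_prodMk_left hS).ennreal_toReal

/-- If `e` has no ties at `P`, both membership in the strict-best event and its failure are
witnessed by strict inequalities continuous in `P`. The indicator is then locally constant at `P`,
and dominated convergence applies. -/
theorem continuous_condBestResponseProb [NeZero J] [IsProbabilityMeasure μ] (hreg : G.Regular μ)
    (hindep : G.IndependentInformation μ) (i : Fin n) (a : Fin J) (x : 𝒳) :
    Continuous fun P => G.condBestResponseProb μ c₀ P i a x := by
  have := Measure.isProbabilityMeasure_map (μ := μ) (hreg.measurable_eps i).aemeasurable
  set S : (Fin n → {a : Fin J // a ≠ 0} → ℝ) → Set (Fin J → ℝ) := fun P =>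
    {e | ∀ b, b ≠ a → G.systematicUtility μ c₀ P i b x - e ⬝ᵥ unitVec b <
      G.systematicUtility μ c₀ P i a x - e ⬝ᵥ unitVec a} with hSdef
  have hS : ∀ P, MeasurableSet (S P) := fun P => measurableSet_strictBest (fun b => by
    simp only [dotProduct_unitVec]
    exact measurable_const.sub (measurable_pi_apply b)) a
  have hint : (fun P => G.condBestResponseProb μ c₀ P i a x) =
      fun P => ∫ e, (S P).indicator (1 : (Fin J → ℝ) → ℝ) e ∂(μ.map (G.eps i)) := by
    funext P
    rw [integral_indicator_one (hS P)]
    rfl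
  rw [hint]
  refine continuous_iff_continuousAt.2 fun P => continuousAt_of_dominated
    (bound := fun _ => (1 : ℝ))
    (Filter.Eventually.of_forall fun Q =>
      (measurable_one.indicator (hS Q)).aestronglyMeasurable)
    (Filter.Eventually.of_forall fun Q => Filter.Eventually.of_forall fun e => ?_)
    (integrable_const _) ?_
  · by_cases he : e ∈ S Q <;> simp [he]
  filter_upwards [hindep.ae_noTies i fun a => G.systematicUtility μ c₀ P i a x] with e he
  have hV : ∀ b, Continuous fun Q => G.systematicUtility μ c₀ Q i b x - e ⬝ᵥ unitVec b :=
    fun b => (continuous_systematicUtility i b x).sub continuous_const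
  have hev : ∀ᶠ Q in nhds P, e ∈ S Q ↔ e ∈ S P := by
    by_cases hP : e ∈ S P
    · have : ∀ b, ∀ᶠ Q in nhds P, b ≠ a → G.systematicUtility μ c₀ Q i b x - e ⬝ᵥ unitVec b <
          G.systematicUtility μ c₀ Q i a x - e ⬝ᵥ unitVec a := by
        intro b
        by_cases hb : b = a
        · simp [hb]
        · filter_upwards [(hV b).continuousAt.eventually_lt (hV a).continuousAt (hP b hb)]
            with Q hQ _ using hQ
      filter_upwards [Filter.eventually_all.2 this] with Q hQ
      exact ⟨fun _ => hP, fun _ => hQ⟩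
    · have hP' := hP
      simp only [hSdef, Set.mem_ofPred_eq, not_forall, not_lt] at hP'
      obtain ⟨b, hb, hle⟩ := hP'
      filter_upwards [(hV a).continuousAt.eventually_lt (hV b).continuousAt
        (lt_of_le_of_ne hle (he a b (Ne.symm hb)))] with Q hQ
      exact ⟨fun h => absurd (h b hb) hQ.not_gt, fun h => absurd h hP⟩
  refine (continuousAt_const (y := (S P).indicator (1 : (Fin J → ℝ) → ℝ) e)).congr ?_
  filter_upwards [hev] with Q hQ
  simp only [Set.indicator_apply, hQ]

theorem continuous_bestResponseMap [NeZero J] [IsProbabilityMeasure μ] (hreg : G.Regular μ)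
    (hindep : G.IndependentInformation μ) (hsep : G.SeparableCost c₀) :
    Continuous (G.bestResponseMap μ c₀) := by
  refine continuous_pi fun i => continuous_pi fun a => ?_
  have := Measure.isProbabilityMeasure_map (μ := μ) (hreg.measurable_X i).aemeasurable
  refine continuous_of_dominated (bound := fun _ => (1 : ℝ))
    (fun P => (measurable_condBestResponseProb hreg hsep P i a.1).aestronglyMeasurable)
    (fun P => Filter.Eventually.of_forall fun x => ?_) (integrable_const _)
    (Filter.Eventually.of_forall fun x => continuous_condBestResponseProb hreg hindep i a.1 x)
  have h := condBestResponseProb_mem_Icc (c₀ := c₀) hreg P i a.1 x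
  rw [Real.norm_of_nonneg h.1]
  exact h.2

theorem exists_bestResponseMap_fixedPoint [NeZero J] [IsProbabilityMeasure μ]
    (hreg : G.Regular μ) (hindep : G.IndependentInformation μ) (hsep : G.SeparableCost c₀) :
    ∃ P ∈ probCube n J, G.bestResponseMap μ c₀ P = P := by
  set Φ : (Fin n × {a : Fin J // a ≠ 0} → ℝ) → Fin n × {a : Fin J // a ≠ 0} → ℝ :=
    fun Q => Function.uncurry (G.bestResponseMap μ c₀ (Function.curry Q)) with hΦ
  have hmem : ∀ Q, Q ∈ Set.Icc (0 : Fin n × {a : Fin J // a ≠ 0} → ℝ) 1 →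
      Function.curry Q ∈ probCube n J :=
    fun Q hQ i a => ⟨hQ.1 (i, a), hQ.2 (i, a)⟩
  have hcont : Continuous Φ := by
    have h1 : Continuous fun Q : Fin n × {a : Fin J // a ≠ 0} → ℝ => Function.curry Q :=
      continuous_pi fun i => continuous_pi fun a => continuous_apply (i, a)
    have h2 := (continuous_bestResponseMap hreg hindep hsep).comp h1
    exact continuous_pi fun p => (continuous_apply_apply p.1 p.2).comp h2
  obtain ⟨Q, hQ, hfix⟩ := exists_fixedPoint_unitCube hcont.continuousOn (fun Q hQ => by
    have h := mapsTo_bestResponseMap (c₀ := c₀) hreg (hmem Q hQ)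
    exact ⟨fun p => (h p.1 p.2).1, fun p => (h p.1 p.2).2⟩)
  refine ⟨Function.curry Q, hmem Q hQ, ?_⟩
  conv_rhs => rw [← hfix]
  rfl

/-- The measurable argmax against `P` has choice probabilities `Ψ(P) = P`, so it is optimal against
its own play, at every type and not just almost every one. -/
theorem exists_isBayesianNash_of_fixedPoint [NeZero J] [IsProbabilityMeasure μ]
    (hreg : G.Regular μ) (hindep : G.IndependentInformation μ) (hsep : G.SeparableCost c₀)
    {P : Fin n → {a : Fin J // a ≠ 0} → ℝ} (hP : G.bestResponseMap μ c₀ P = P) :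
    ∃ σ, G.IsBayesianNash μ σ ∧ G.choiceProb μ σ = P := by
  have hV : ∀ i b, Measurable fun p : 𝒳 × (Fin J → ℝ) =>
      G.systematicUtility μ c₀ P i b p.1 - p.2 ⬝ᵥ unitVec b := by
    intro i b
    simp only [dotProduct_unitVec]
    exact ((measurable_systematicUtility hreg hsep P i b).comp measurable_fst).sub
      ((measurable_pi_apply b).comp measurable_snd)
  choose f hfm hf using fun i => exists_measurable_argmax (hV i)
  have hprob : G.choiceProb μ (fun i x e => f i (x, e)) = P :=
    (choiceProb_eq_bestResponseMap hindep fun i x e a => hf i (x, e) a).trans hP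
  refine ⟨fun i x e => f i (x, e), ⟨hfm, fun i x e a => ?_⟩, hprob⟩
  rw [expectedUtility_eq hreg hindep hsep hfm, expectedUtility_eq hreg hindep hsep hfm, hprob]
  exact hf i (x, e) a

end

end EducationGame

theorem mainTheorem2 {n m J : ℕ} [NeZero J] {𝒳 Ω : Type*} [MeasurableSpace 𝒳] [MeasurableSpace Ω]
    (μ : Measure Ω) [IsProbabilityMeasure μ] (G : EducationGame n m J 𝒳 Ω)
    (c₀ : Fin J → 𝒳 → ℝ) (hreg : G.Regular μ) (hindep : G.IndependentInformation μ)
    (hsep : G.SeparableCost c₀) :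
    (∃ σ, G.IsBayesianNash μ σ) ∧
    Set.MapsTo (G.bestResponseMap μ c₀) (probCube n J) (probCube n J) ∧
    (∀ σ, G.IsBayesianNash μ σ →
      G.choiceProb μ σ ∈ probCube n J ∧
      G.bestResponseMap μ c₀ (G.choiceProb μ σ) = G.choiceProb μ σ) ∧
    (∀ P ∈ probCube n J, G.bestResponseMap μ c₀ P = P →
      ∃ σ, G.IsBayesianNash μ σ ∧ G.choiceProb μ σ = P) := by
  refine ⟨?_, EducationGame.mapsTo_bestResponseMap hreg, fun σ hσ =>
    ⟨EducationGame.choiceProb_mem_probCube hreg hindep hσ.1, ?_⟩, fun P _ hP =>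
    EducationGame.exists_isBayesianNash_of_fixedPoint hreg hindep hsep hP⟩
  · obtain ⟨P, -, hP⟩ :=
      EducationGame.exists_bestResponseMap_fixedPoint hreg hindep hsep
    obtain ⟨σ, hσ, -⟩ :=
      EducationGame.exists_isBayesianNash_of_fixedPoint hreg hindep hsep hP
    exact ⟨σ, hσ⟩
  -- By `expectedUtility_eq`, equilibrium is optimality against the profile's own choice
  -- probabilities.
  · refine (EducationGame.choiceProb_eq_bestResponseMap hindep fun i x e a => ?_).symm
    have h := hσ.2 i x e a
    rwa [EducationGame.expectedUtility_eq hreg hindep hsep hσ.1,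
      EducationGame.expectedUtility_eq hreg hindep hsep hσ.1] at h
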